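/- Let $d\ge 3$ and $N\ge 1$, let $\mathbb S^{d-1}\subset\mathbb R^d$ be the Euclidean unit sphere and $\sigma$ the uniform probability distribution on $\mathbb S^{d-1}$. For $X=(x^{(1)},\dots,x^{(N)})\in(\mathbb S^{d-1})^N$ the spherical cap discrepancy is $$\Delta(X)=\sup_{w\in\mathbb S^{d-1},\ t\in[-1,1]}\left|\frac1N\,\#\{i\in\{1,\dots,N\} : \langle w,x^{(i)}\rangle\ge t\}-\sigma\big(\{x\in\mathbb S^{d-1} : \langle w,x\rangle\ge t\}\big)\right| .$$ A tuple $X\in(\mathbb R^d)^N$ is called generic if for every $I\subseteq\{1,\dots,N\}$ with $\#I\le d$ the family $(x^{(i)})_{i\in I}$ is linearly independent. Let $\bar X\in(\mathbb S^{d-1})^N$ be generic. Then there exists a neighbourhood $\mathcal U$ of $\bar X$ in $(\mathbb R^d)^N$ such that every $X\in\mathcal U\cap(\mathbb S^{d-1})^N$ is generic and $\Delta$ is Lipschitz continuous on $\mathcal U\cap(\mathbb S^{d-1})^N$, i.e. there exists $L>0$ with $$|\Delta(X_1)-\Delta(X_2)|\le L\,\|X_1-X_2\|\qquad\text{for all }X_1,X_2\in\mathcal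 U\cap(\mathbb S^{d-1})^N,$$ where $\|\cdot\|$ is the Euclidean norm on $(\mathbb R^d)^N$. -/

import Mathlib

open MeasureTheory Metric Topology

noncomputable section

/-- The space `(ℝ^d)^N` of `N`-tuples of points of `ℝ^d`, with its Euclidean norm
`‖X‖² = ∑ i, ‖X i‖²`. -/
abbrev PointSets (d N : ℕ) : Type :=
  PiLp 2 (fun _ : Fin N => EuclideanSpace ℝ (Fin d))

/-- The subset `(𝕊^{d-1})^N` of `(ℝ^d)^N`: all points have norm one. -/
def onSphere (d N : ℕ) : Set (PointSets d N) :=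
  {X | ∀ i, X i ∈ sphere (0 : EuclideanSpace ℝ (Fin d)) 1}

/-- `H(w, t) = {x | ⟨w, x⟩ ≥ t}`. -/
def halfSpace {d : ℕ} (w : EuclideanSpace ℝ (Fin d)) (t : ℝ) :
    Set (EuclideanSpace ℝ (Fin d)) :=
  {x | t ≤ inner ℝ w x}

/-- The uniform distribution `σ` on `𝕊^{d-1}`: the surface measure, normalized to total mass one. -/
def uniformSphere (d : ℕ) : Measure (sphere (0 : EuclideanSpace ℝ (Fin d)) 1) :=
  ((volume : Measure (EuclideanSpace ℝ (Fin d))).toSphere Set.univ)⁻¹ •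
    (volume : Measure (EuclideanSpace ℝ (Fin d))).toSphere

/-- The cap measure `σ(𝕊^{d-1} ∩ H(w, t))`. -/
def capMeasure {d : ℕ} (w : EuclideanSpace ℝ (Fin d)) (t : ℝ) : ℝ :=
  (uniformSphere d).real {x | (x : EuclideanSpace ℝ (Fin d)) ∈ halfSpace w t}

/-- The empirical measure `N⁻¹ · #{i | X i ∈ H(w, t)}`. -/
def empMeasure {d N : ℕ} (X : PointSets d N) (w : EuclideanSpace ℝ (Fin d)) (t : ℝ) : ℝ :=
  (N : ℝ)⁻¹ * (Set.ncard {i : Fin N | X i ∈ halfSpace w t} : ℝ)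

/-- The spherical cap discrepancy: the supremum of the local discrepancies over all spherical caps,
that is, over all `(w, t) ∈ 𝕊^{d-1} × [-1, 1]`. -/
def capDiscrepancy {d N : ℕ} (X : PointSets d N) : ℝ :=
  ⨆ p : sphere (0 : EuclideanSpace ℝ (Fin d)) 1 × Set.Icc (-1 : ℝ) 1,
    |empMeasure X (p.1 : EuclideanSpace ℝ (Fin d)) (p.2 : ℝ)
      - capMeasure (p.1 : EuclideanSpace ℝ (Fin d)) (p.2 : ℝ)|

/-- A point set is generic if every subfamily of at most `d` of its points is linearly
independent. -/
def Generic {d N : ℕ} (X : PointSets d N) : Prop :=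
  ∀ I : Finset (Fin N), I.card ≤ d → LinearIndependent ℝ (fun i : I => X i)

end

/-! The discrepancy is in fact Lipschitz on all of the product of spheres; the neighbourhood is just
the open set of generic tuples. If all points move by at most `η`, every height `⟨w, x⟩` moves by at
most `η`, so the empirical measure of a cap at height `t` lies between those of the moved tuple at
heights `t + η` and `t - η`. This costs a change of cap measure, hence everything rests on
`exists_capMeasure_sub_le`: cap measure is Lipschitz in the height, uniformly in `w`.

That bound holds because for `d ≥ 3` the height of a uniform point has a bounded density. The
density is never computed. The measure of a strip of the sphere is `d` times the volume of the cone
over it, and Fubini estimates this volume: along lines parallel to the axis for strips away from the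
poles, over discs orthogonal to the axis for strips near a pole. -/

/-! ### Volumes of conic strips. -/

/-- The closed conic strip in `ℝ × F` of vectors `p` of Euclidean norm at most one whose direction
has height between `t` and `s` along the first axis. -/
def conicStrip (F : Type*) [NormedAddCommGroup F] (t s : ℝ) : Set (ℝ × F) :=
  {p | p.1 ^ 2 + ‖p.2‖ ^ 2 ≤ 1 ∧ t * √(p.1 ^ 2 + ‖p.2‖ ^ 2) ≤ p.1 ∧
    p.1 ≤ s * √(p.1 ^ 2 + ‖p.2‖ ^ 2)}

theorem isClosed_conicStrip (F : Type*) [NormedAddCommGroup F] (t s : ℝ) :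
    IsClosed (conicStrip F t s) := by
  simp only [conicStrip, Set.ofPred_and]
  refine IsClosed.inter (isClosed_le ?_ ?_)
    (IsClosed.inter (isClosed_le ?_ ?_) (isClosed_le ?_ ?_)) <;> fun_prop

/-- This puts the cone condition into slope form `t / √(1 - t²) ≤ a / r`, which is linear in `a`.
Where both sides have the same sign it follows by squaring. -/
theorem mul_le_mul_sqrt_one_sub_sq {t a r : ℝ} (ht : t ^ 2 ≤ 1) (hr : 0 ≤ r)
    (h : t * √(a ^ 2 + r ^ 2) ≤ a) : t * r ≤ a * √(1 - t ^ 2) := by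
  have hρ : √(a ^ 2 + r ^ 2) ^ 2 = a ^ 2 + r ^ 2 := Real.sq_sqrt (by positivity)
  have hc : √(1 - t ^ 2) ^ 2 = 1 - t ^ 2 := Real.sq_sqrt (by linarith)
  have hρ0 := Real.sqrt_nonneg (a ^ 2 + r ^ 2)
  have hc0 := Real.sqrt_nonneg (1 - t ^ 2)
  set ρ := √(a ^ 2 + r ^ 2)
  set c := √(1 - t ^ 2)
  rcases le_or_gt 0 t with h0 | h0
  · have ha : 0 ≤ a := (mul_nonneg h0 hρ0).trans h
    have h2 : (t * ρ) ^ 2 ≤ a ^ 2 := pow_le_pow_left₀ (by positivity) h 2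
    refine le_of_sq_le_sq ?_ (by positivity)
    rw [mul_pow, mul_pow, hc]
    rw [mul_pow, hρ] at h2
    linarith
  · rcases le_or_gt 0 a with ha | ha
    · exact (mul_nonpos_of_nonpos_of_nonneg h0.le hr).trans (by positivity)
    · have h2 : (-a) ^ 2 ≤ (-(t * ρ)) ^ 2 := pow_le_pow_left₀ (by linarith) (by linarith) 2
      have h3 : -a * c ≤ -t * r := by
        refine le_of_sq_le_sq ?_ (mul_nonneg (by linarith) hr)
        rw [mul_pow, mul_pow, hc]
        rw [neg_sq, neg_sq, mul_pow, hρ] at h2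
        linarith
      linarith

/-- The slope `x / √(1 - x²)` has bounded derivative away from `±1`; the factorisation `key`
replaces the mean value theorem. -/
theorem div_sqrt_one_sub_sq_sub_le {t s : ℝ} (hts : t ≤ s) (ht : |t| ≤ 3 / 4) (hs : |s| ≤ 3 / 4) :
    s / √(1 - s ^ 2) - t / √(1 - t ^ 2) ≤ 8 * (s - t) := by
  have bound : ∀ x : ℝ, |x| ≤ 3 / 4 → 1 / 2 ≤ √(1 - x ^ 2) ∧ √(1 - x ^ 2) ^ 2 = 1 - x ^ 2 := by
    intro x hx
    have hx2 : x ^ 2 ≤ (3 / 4) ^ 2 := sq_le_sq' (abs_le.1 hx).1 (abs_le.1 hx).2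
    exact ⟨Real.le_sqrt_of_sq_le (by linarith), Real.sq_sqrt (by linarith)⟩
  obtain ⟨hc, hc2⟩ := bound s hs
  obtain ⟨he, he2⟩ := bound t ht
  set c := √(1 - s ^ 2)
  set e := √(1 - t ^ 2)
  have hc0 : 0 < c := by linarith
  have he0 : 0 < e := by linarith
  have key : s / c - t / e = (s - t) * (1 / c + t * (s + t) / (c * e * (c + e))) := by
    have hce : c + e ≠ 0 := by positivity
    have h1 : (e - c) * (c + e) = (s - t) * (s + t) := by linear_combination he2 - hc2
    field_simp
    linear_combination t * h1
  rw [key, mul_comm 8]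
  refine mul_le_mul_of_nonneg_left ?_ (by linarith)
  have h1 : 1 / c ≤ 2 := by rw [div_le_iff₀ hc0]; linarith
  have h2 : t * (s + t) ≤ 6 / 4 := by
    have := abs_le.1 ht
    have := abs_le.1 hs
    nlinarith [abs_le.1 ht, abs_le.1 hs]
  have h3 : 1 / 4 ≤ c * e * (c + e) := by
    have h4 : 1 / 4 ≤ c * e := by nlinarith
    nlinarith
  have h5 : t * (s + t) / (c * e * (c + e)) ≤ 6 := by
    rw [div_le_iff₀ (by linarith)]; linarith
  linarith

/-- For a fixed orthogonal part `z`, the slice is contained in an interval whose endpoints are the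
two slopes times `‖z‖`. -/
theorem volume_conicStrip_le_of_abs_le {n : ℕ} {t s : ℝ} (hts : t ≤ s) (ht : |t| ≤ 3 / 4)
    (hs : |s| ≤ 3 / 4) :
    volume (conicStrip (EuclideanSpace ℝ (Fin n)) t s) ≤
      ENNReal.ofReal (8 * (s - t)) * volume (closedBall (0 : EuclideanSpace ℝ (Fin n)) 1) := by
  rw [Measure.volume_eq_prod, Measure.prod_apply_symm (isClosed_conicStrip _ t s).measurableSet,
    ← setLIntegral_const, ← lintegral_indicator measurableSet_closedBall]
  refine lintegral_mono fun z => ?_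
  by_cases hz : z ∈ closedBall (0 : EuclideanSpace ℝ (Fin n)) 1
  · rw [Set.indicator_of_mem hz]
    have hz1 : ‖z‖ ≤ 1 := by simpa using hz
    have bound : ∀ x : ℝ, |x| ≤ 3 / 4 → 0 < √(1 - x ^ 2) ∧ x ^ 2 ≤ 1 := by
      intro x hx
      have hx2 : x ^ 2 ≤ (3 / 4) ^ 2 := sq_le_sq' (abs_le.1 hx).1 (abs_le.1 hx).2
      exact ⟨Real.sqrt_pos.2 (by linarith), by linarith⟩
    obtain ⟨hc, hs1⟩ := bound s hs
    obtain ⟨he, ht1⟩ := bound t ht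
    have hsub : (fun a : ℝ => (a, z)) ⁻¹' conicStrip (EuclideanSpace ℝ (Fin n)) t s ⊆
        Set.Icc (t / √(1 - t ^ 2) * ‖z‖) (s / √(1 - s ^ 2) * ‖z‖) := by
      rintro a ⟨-, h1, h2⟩
      simp only at h1 h2
      constructor
      · rw [div_mul_eq_mul_div, div_le_iff₀ he]
        exact mul_le_mul_sqrt_one_sub_sq ht1 (norm_nonneg z) h1
      · have := mul_le_mul_sqrt_one_sub_sq (t := -s) (a := -a) (by simpa using hs1)
          (norm_nonneg z) (by rw [neg_sq]; linarith)
        rw [div_mul_eq_mul_div, le_div_iff₀ hc]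
        rw [neg_sq] at this
        linarith
    refine (measure_mono hsub).trans ?_
    rw [Real.volume_Icc, ← sub_mul]
    refine ENNReal.ofReal_le_ofReal ?_
    calc _ ≤ 8 * (s - t) * ‖z‖ :=
          mul_le_mul_of_nonneg_right (div_sqrt_one_sub_sq_sub_le hts ht hs) (norm_nonneg z)
      _ ≤ 8 * (s - t) * 1 := mul_le_mul_of_nonneg_left hz1 (by linarith)
      _ = _ := mul_one _
  · rw [Set.indicator_of_notMem hz]
    suffices (fun a : ℝ => (a, z)) ⁻¹' conicStrip (EuclideanSpace ℝ (Fin n)) t s = ∅ by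
      rw [this, measure_empty]
    refine Set.eq_empty_of_forall_notMem fun a ha => hz ?_
    have h1 : a ^ 2 + ‖z‖ ^ 2 ≤ 1 := ha.1
    rw [mem_closedBall_zero_iff, ← sq_le_one_iff₀ (norm_nonneg z)]
    nlinarith [sq_nonneg a]

/-- For `n ≥ 2` the bound `n * R ^ (n - 1) * (R - r)` has a spare factor `R`, and `R * (R - r) ≤ R²
- r²`. For `n = 1` no such bound holds near `0`; this is where `d ≥ 3` enters. -/
theorem pow_sub_pow_le_of_sq {n : ℕ} (hn : 2 ≤ n) {r R : ℝ} (hr : 0 ≤ r) (hrR : r ≤ R)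
    (hR : R ≤ 2) : R ^ n - r ^ n ≤ n * 2 ^ n * (R ^ 2 - r ^ 2) := by
  have hR0 : 0 ≤ R := hr.trans hrR
  have h1 := (le_abs_self _).trans (abs_pow_sub_pow_le R r n)
  rw [abs_of_nonneg hr, abs_of_nonneg hR0, abs_of_nonneg (sub_nonneg.2 hrR),
    max_eq_left hrR] at h1
  obtain ⟨m, rfl⟩ := Nat.exists_eq_add_of_le' hn
  refine h1.trans ?_
  have h2 : R ^ (m + 2 - 1) = R ^ m * R := by rw [← pow_succ]; rfl
  have h3 : R ^ m ≤ 2 ^ (m + 2) :=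
    (pow_le_pow_left₀ hR0 hR m).trans (pow_le_pow_right₀ (by norm_num) (by omega))
  have h4 : R * (R - r) ≤ R ^ 2 - r ^ 2 := by nlinarith
  have h5 : 0 ≤ R * (R - r) := mul_nonneg hR0 (by linarith)
  calc (R - r) * ((m + 2 : ℕ) : ℝ) * R ^ (m + 2 - 1)
      = ((m + 2 : ℕ) : ℝ) * (R ^ m * (R * (R - r))) := by rw [h2]; ring
    _ ≤ ((m + 2 : ℕ) : ℝ) * (2 ^ (m + 2) * (R ^ 2 - r ^ 2)) := by gcongr
    _ = _ := by ring

theorem volume_annulus_le {n : ℕ} (hn : 2 ≤ n) {r R : ℝ} (hr : 0 ≤ r) (hrR : r ≤ R)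
    (hR : R ≤ 2) :
    volume (closedBall (0 : EuclideanSpace ℝ (Fin n)) R \ ball 0 r) ≤
      ENNReal.ofReal (n * 2 ^ n * (R ^ 2 - r ^ 2)) *
        volume (ball (0 : EuclideanSpace ℝ (Fin n)) 1) := by
  have : Nonempty (Fin n) := ⟨⟨0, by omega⟩⟩
  rw [measure_sdiff (ball_subset_closedBall.trans (closedBall_subset_closedBall hrR))
    measurableSet_ball.nullMeasurableSet measure_ball_lt_top.ne,
    Measure.addHaar_closedBall _ _ (hr.trans hrR), Measure.addHaar_ball _ _ hr,
    ← ENNReal.sub_mul (fun _ _ => measure_ball_lt_top.ne), finrank_euclideanSpace_fin,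
    ← ENNReal.ofReal_sub _ (by positivity)]
  gcongr
  exact pow_sub_pow_le_of_sq hn hr hrR hR

/-- At fixed height `a` the slice lies in an annulus. Its squared radii `a² (1 / t² - 1)` and `a² (1
/ s² - 1)` are Lipschitz in `t` and `s` up to the pole, unlike the radii themselves. -/
theorem volume_conicStrip_le_of_half_le {n : ℕ} (hn : 2 ≤ n) {t s : ℝ} (ht : 1 / 2 ≤ t)
    (hts : t ≤ s) (hs : s ≤ 1) :
    volume (conicStrip (EuclideanSpace ℝ (Fin n)) t s) ≤
      ENNReal.ofReal (n * 2 ^ n * (32 * (s - t))) *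
        volume (ball (0 : EuclideanSpace ℝ (Fin n)) 1) := by
  have ht0 : 0 < t := by linarith
  have hs0 : 0 < s := by linarith
  have hs2 : 0 ≤ 1 / s ^ 2 - 1 := by
    rw [sub_nonneg, le_div_iff₀ (by positivity)]; nlinarith
  have hst : 1 / s ^ 2 - 1 ≤ 1 / t ^ 2 - 1 := by gcongr
  have ht4 : 1 / t ^ 2 - 1 ≤ 3 := by
    rw [sub_le_iff_le_add, div_le_iff₀ (by positivity)]; nlinarith
  -- Here `s + t ≤ 2` and `s² t² ≥ 1 / 16`, whence 32.
  have hdiff : (1 / t ^ 2 - 1) - (1 / s ^ 2 - 1) ≤ 32 * (s - t) := by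
    have : (1 / t ^ 2 - 1) - (1 / s ^ 2 - 1) = (s - t) * ((s + t) / (s ^ 2 * t ^ 2)) := by
      field_simp; ring
    rw [this, mul_comm 32]
    refine mul_le_mul_of_nonneg_left ?_ (by linarith)
    rw [div_le_iff₀ (by positivity)]
    have h1 : 1 / 4 ≤ t ^ 2 := by nlinarith
    have h2 : 1 / 4 ≤ s ^ 2 := by nlinarith
    nlinarith
  set K := ENNReal.ofReal (n * 2 ^ n * (32 * (s - t))) *
        volume (ball (0 : EuclideanSpace ℝ (Fin n)) 1)
  have hK : K = ∫⁻ a : ℝ, (Set.Icc (0 : ℝ) 1).indicator (fun _ => K) a := by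
    rw [lintegral_indicator measurableSet_Icc, setLIntegral_const, Real.volume_Icc]
    simp
  rw [Measure.volume_eq_prod, Measure.prod_apply (isClosed_conicStrip _ t s).measurableSet, hK]
  refine lintegral_mono fun a => ?_
  by_cases ha : a ∈ Set.Icc (0 : ℝ) 1
  · rw [Set.indicator_of_mem ha]
    obtain ⟨ha0, ha1⟩ := ha
    set R := a * √(1 / t ^ 2 - 1) with hRdef
    set r := a * √(1 / s ^ 2 - 1) with hrdef
    have hR2 : R ^ 2 = a ^ 2 * (1 / t ^ 2 - 1) := by
      rw [hRdef, mul_pow, Real.sq_sqrt (hs2.trans hst)]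
    have hr2 : r ^ 2 = a ^ 2 * (1 / s ^ 2 - 1) := by
      rw [hrdef, mul_pow, Real.sq_sqrt hs2]
    have hr0 : 0 ≤ r := by positivity
    have hR0 : 0 ≤ R := by positivity
    have ha2 : a ^ 2 ≤ 1 := by nlinarith
    have hrR : r ≤ R := mul_le_mul_of_nonneg_left (Real.sqrt_le_sqrt hst) ha0
    have hR : R ≤ 2 := by
      refine le_of_sq_le_sq ?_ (by norm_num)
      rw [hR2]
      nlinarith
    have hsub : Prod.mk a ⁻¹' conicStrip (EuclideanSpace ℝ (Fin n)) t s ⊆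
        closedBall 0 R \ ball 0 r := by
      rintro z ⟨-, h1, h2⟩
      simp only at h1 h2
      have hρ : √(a ^ 2 + ‖z‖ ^ 2) ^ 2 = a ^ 2 + ‖z‖ ^ 2 := Real.sq_sqrt (by positivity)
      have h1' := pow_le_pow_left₀ (by positivity) h1 2
      have h2' := pow_le_pow_left₀ ha0 h2 2
      rw [mul_pow, hρ] at h1' h2'
      constructor
      · rw [mem_closedBall_zero_iff]
        refine le_of_sq_le_sq ?_ hR0
        rw [hR2, mul_sub, mul_one_div, mul_one, le_sub_iff_add_le, le_div_iff₀ (by positivity)]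
        linarith
      · rw [mem_ball_zero_iff, not_lt]
        refine le_of_sq_le_sq ?_ (norm_nonneg z)
        rw [hr2, mul_sub, mul_one_div, mul_one, sub_le_iff_le_add, div_le_iff₀ (by positivity)]
        linarith
    refine (measure_mono hsub).trans ((volume_annulus_le hn hr0 hrR hR).trans ?_)
    refine mul_le_mul_left (ENNReal.ofReal_le_ofReal ?_) _
    refine mul_le_mul_of_nonneg_left ?_ (by positivity)
    rw [hR2, hr2, ← mul_sub]
    nlinarith
  · rw [Set.indicator_of_notMem ha]
    suffices Prod.mk a ⁻¹' conicStrip (EuclideanSpace ℝ (Fin n)) t s = ∅ by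
      rw [this, measure_empty]
    refine Set.eq_empty_of_forall_notMem fun z hz => ha ⟨?_, ?_⟩
    · exact (by positivity : 0 ≤ t * √(a ^ 2 + ‖z‖ ^ 2)).trans hz.2.1
    · have h1 : a ^ 2 + ‖z‖ ^ 2 ≤ 1 := hz.1
      nlinarith [sq_nonneg ‖z‖]

/-! ### Strips of the sphere and cap measure. -/

theorem exists_measurePreserving_prod {n : ℕ} {w : EuclideanSpace ℝ (Fin (n + 1))}
    (hw : ‖w‖ = 1) :
    ∃ φ : EuclideanSpace ℝ (Fin (n + 1)) → ℝ × EuclideanSpace ℝ (Fin n),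
      MeasurePreserving φ volume volume ∧
        ∀ y, (φ y).1 = inner ℝ w y ∧ (φ y).1 ^ 2 + ‖(φ y).2‖ ^ 2 = ‖y‖ ^ 2 := by
  have hortho : Orthonormal ℝ (({0} : Set (Fin (n + 1))).domRestrict fun _ => w) := by
    refine ⟨fun _ => hw, fun i j hij => (hij ?_).elim⟩
    exact Subtype.ext ((Set.mem_singleton_iff.1 i.2).trans (Set.mem_singleton_iff.1 j.2).symm)
  obtain ⟨b, hb⟩ := hortho.exists_orthonormalBasis_extension_of_card_eq (by simp)
  have hb0 : b 0 = w := hb 0 rfl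
  refine ⟨fun y => (b.repr y 0, WithLp.toLp 2 fun i => b.repr y i.succ), ?_, fun y => ⟨?_, ?_⟩⟩
  · have h := ((MeasurePreserving.id (volume : Measure ℝ)).prod
      (PiLp.volume_preserving_toLp (Fin n))).comp
        ((volume_preserving_piFinSuccAbove (fun _ : Fin (n + 1) => ℝ) 0).comp
          ((PiLp.volume_preserving_ofLp (Fin (n + 1))).comp b.measurePreserving_repr))
    exact h
  · simp only [b.repr_apply_apply, hb0]
  · rw [← b.repr.norm_map y, EuclideanSpace.norm_sq_eq, EuclideanSpace.norm_sq_eq,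
      Fin.sum_univ_succ]
    simp

/-- The closed strip `{x | t ≤ ⟨w, x⟩ ≤ s}` of the unit sphere. -/
def sphereStrip {d : ℕ} (w : EuclideanSpace ℝ (Fin d)) (t s : ℝ) :
    Set (sphere (0 : EuclideanSpace ℝ (Fin d)) 1) :=
  {x | t ≤ inner ℝ w (x : EuclideanSpace ℝ (Fin d)) ∧
    inner ℝ w (x : EuclideanSpace ℝ (Fin d)) ≤ s}

theorem measurableSet_sphereStrip {d : ℕ} (w : EuclideanSpace ℝ (Fin d)) (t s : ℝ) :
    MeasurableSet (sphereStrip w t s) := by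
  refine IsClosed.measurableSet ?_
  simp only [sphereStrip, Set.ofPred_and]
  refine IsClosed.inter (isClosed_le ?_ ?_) (isClosed_le ?_ ?_) <;> fun_prop

theorem sphereStrip_neg {d : ℕ} (w : EuclideanSpace ℝ (Fin d)) (t s : ℝ) :
    sphereStrip (-w) (-s) (-t) = sphereStrip w t s := by
  ext x
  simp [sphereStrip, and_comm]

/-- By definition `toSphere` is the dimension times the volume of the cone over the set; in
coordinates along `w` this cone lies in the conic strip. -/
theorem toSphere_sphereStrip_le {n : ℕ} {w : EuclideanSpace ℝ (Fin (n + 1))} (hw : ‖w‖ = 1)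
    (t s : ℝ) :
    (volume : Measure (EuclideanSpace ℝ (Fin (n + 1)))).toSphere (sphereStrip w t s) ≤
      (n + 1 : ℕ) * volume (conicStrip (EuclideanSpace ℝ (Fin n)) t s) := by
  obtain ⟨φ, hφ, hφ'⟩ := exists_measurePreserving_prod hw
  rw [Measure.toSphere_apply' _ (measurableSet_sphereStrip w t s), finrank_euclideanSpace_fin,
    ← hφ.measure_preimage (isClosed_conicStrip _ t s).measurableSet.nullMeasurableSet]
  refine mul_le_mul_right (measure_mono ?_) _
  rintro _ ⟨r, ⟨hr0, hr1⟩, _, ⟨x, ⟨hx1, hx2⟩, rfl⟩, rfl⟩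
  obtain ⟨h1, h2⟩ := hφ' (r • (x : EuclideanSpace ℝ (Fin (n + 1))))
  have hnorm : ‖r • (x : EuclideanSpace ℝ (Fin (n + 1)))‖ = r := by
    rw [norm_smul, norm_eq_of_mem_sphere x, mul_one, Real.norm_of_nonneg hr0.le]
  refine ⟨?_, ?_, ?_⟩
  · rw [h2, hnorm]
    nlinarith
  all_goals simp only; rw [h2, hnorm, Real.sqrt_sq hr0.le, h1, real_inner_smul_right]
  · rw [mul_comm]
    exact mul_le_mul_of_nonneg_left hx1 hr0.le
  · rw [mul_comm s]
    exact mul_le_mul_of_nonneg_left hx2 hr0.le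

instance isProbabilityMeasure_uniformSphere {n : ℕ} :
    IsProbabilityMeasure (uniformSphere (n + 1)) := by
  refine ⟨?_⟩
  rw [uniformSphere, Measure.smul_apply, smul_eq_mul]
  refine ENNReal.inv_mul_cancel ?_ (measure_ne_top _ _)
  rw [Measure.measure_univ_ne_zero]
  exact Measure.toSphere_ne_zero _

theorem exists_toSphere_sphereStrip_le {n : ℕ} (hn : 2 ≤ n) :
    ∃ K : ENNReal, K ≠ ⊤ ∧ ∀ w : EuclideanSpace ℝ (Fin (n + 1)), ‖w‖ = 1 → ∀ t s : ℝ, t ≤ s →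
      (volume : Measure (EuclideanSpace ℝ (Fin (n + 1)))).toSphere (sphereStrip w t s) ≤
        ENNReal.ofReal (s - t) * K := by
  set ν := (volume : Measure (EuclideanSpace ℝ (Fin (n + 1)))).toSphere
  set B := volume (ball (0 : EuclideanSpace ℝ (Fin n)) 1)
  set B' := volume (closedBall (0 : EuclideanSpace ℝ (Fin n)) 1)
  have hB : B ≠ ⊤ := measure_ball_lt_top.ne
  have hB' : B' ≠ ⊤ := measure_closedBall_lt_top.ne
  set K₁ := (n + 1 : ℕ) * (ENNReal.ofReal (n * 2 ^ n * 32) * B) with hK₁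
  set K₂ := (n + 1 : ℕ) * (ENNReal.ofReal 8 * B') with hK₂
  set K₃ := ENNReal.ofReal 4 * ν Set.univ with hK₃
  have high : ∀ w : EuclideanSpace ℝ (Fin (n + 1)), ‖w‖ = 1 → ∀ t s : ℝ, 1 / 2 ≤ t → t ≤ s →
      ν (sphereStrip w t s) ≤ ENNReal.ofReal (s - t) * K₁ := by
    intro w hw t s ht hts
    rcases le_or_gt t 1 with ht1 | ht1
    -- No point of the sphere has height above 1, so the strip may be cut there.
    · have hle : sphereStrip w t s ⊆ sphereStrip w t (min s 1) := by
        rintro x ⟨h1, h2⟩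
        refine ⟨h1, le_min h2 ?_⟩
        have := real_inner_le_norm w x
        rwa [hw, norm_eq_of_mem_sphere x, mul_one] at this
      have hmin : t ≤ min s 1 := le_min hts ht1
      refine (measure_mono hle).trans ((toSphere_sphereStrip_le hw _ _).trans ?_)
      refine (mul_le_mul_right (volume_conicStrip_le_of_half_le hn ht hmin
        (min_le_right _ _)) _).trans ?_
      rw [← mul_assoc (_ * _ : ℝ), mul_comm _ (min s 1 - t),
        ENNReal.ofReal_mul (by linarith), mul_assoc, mul_left_comm, hK₁]
      gcongr
      exact min_le_left _ _
    · have : sphereStrip w t s = ∅ := by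
        refine Set.eq_empty_of_forall_notMem fun x hx => ?_
        have := real_inner_le_norm w x
        rw [hw, norm_eq_of_mem_sphere x, mul_one] at this
        linarith [hx.1]
      rw [this, measure_empty]
      exact zero_le
  refine ⟨K₁ + K₂ + K₃, ?_, fun w hw t s hts => ?_⟩
  · refine ENNReal.add_ne_top.2 ⟨ENNReal.add_ne_top.2 ⟨?_, ?_⟩, ?_⟩
    · exact ENNReal.mul_ne_top (ENNReal.natCast_ne_top _) (ENNReal.mul_ne_top (by simp) hB)
    · exact ENNReal.mul_ne_top (ENNReal.natCast_ne_top _) (ENNReal.mul_ne_top (by simp) hB')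
    · exact ENNReal.mul_ne_top (by simp) (measure_ne_top _ _)
  have le₁ : K₁ ≤ K₁ + K₂ + K₃ := le_self_add.trans le_self_add
  have le₂ : K₂ ≤ K₁ + K₂ + K₃ := le_add_self.trans le_self_add
  have le₃ : K₃ ≤ K₁ + K₂ + K₃ := le_add_self
  rcases le_or_gt (1 / 4) (s - t) with hlong | hshort
  · refine le_trans ?_ (mul_le_mul_right le₃ _)
    rw [hK₃, ← mul_assoc, ← ENNReal.ofReal_mul (by linarith)]
    refine (measure_mono (Set.subset_univ _)).trans ?_
    refine le_mul_of_one_le_left (zero_le) ?_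
    rw [ENNReal.one_le_ofReal]
    linarith
  -- A strip shorter than `1 / 4` lies above `1 / 2`, below `-1 / 2` (reflected to the first case),
  -- or within `[-3 / 4, 3 / 4]`.
  rcases le_or_gt (1 / 2) t with ht | ht
  · exact (high w hw t s ht hts).trans (mul_le_mul_right le₁ _)
  rcases le_or_gt s (-(1 / 2)) with hs | hs
  · rw [← sphereStrip_neg]
    refine (high (-w) (by rwa [norm_neg]) (-s) (-t) (by linarith) (by linarith)).trans ?_
    rw [neg_sub_neg]
    exact mul_le_mul_right le₁ _
  · refine le_trans ?_ (mul_le_mul_right le₂ _)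
    refine (toSphere_sphereStrip_le hw _ _).trans ?_
    refine (mul_le_mul_right (volume_conicStrip_le_of_abs_le hts
      (abs_le.2 ⟨by linarith, by linarith⟩) (abs_le.2 ⟨by linarith, by linarith⟩)) _).trans ?_
    rw [mul_comm (8 : ℝ), ENNReal.ofReal_mul (by linarith), mul_assoc, mul_left_comm]

theorem exists_capMeasure_sub_le {n : ℕ} (hn : 2 ≤ n) :
    ∃ C : ℝ, 0 ≤ C ∧ ∀ w : EuclideanSpace ℝ (Fin (n + 1)), ‖w‖ = 1 → ∀ t s : ℝ, t ≤ s →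
      capMeasure w t - capMeasure w s ≤ C * (s - t) := by
  obtain ⟨K, hK, hbound⟩ := exists_toSphere_sphereStrip_le hn
  set ν := (volume : Measure (EuclideanSpace ℝ (Fin (n + 1)))).toSphere with hν
  refine ⟨((ν Set.univ)⁻¹ * K).toReal, ENNReal.toReal_nonneg, fun w hw t s hts => ?_⟩
  have hinv : (ν Set.univ)⁻¹ ≠ ⊤ := by
    rw [ENNReal.inv_ne_top, Measure.measure_univ_ne_zero]
    exact Measure.toSphere_ne_zero _
  have hstrip : (uniformSphere (n + 1)).real (sphereStrip w t s) ≤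
      ((ν Set.univ)⁻¹ * K).toReal * (s - t) := by
    refine ENNReal.toReal_le_of_le_ofReal
      (mul_nonneg ENNReal.toReal_nonneg (by linarith)) ?_
    rw [ENNReal.ofReal_mul ENNReal.toReal_nonneg,
      ENNReal.ofReal_toReal (ENNReal.mul_ne_top hinv hK), uniformSphere, Measure.smul_apply,
      smul_eq_mul, mul_assoc, mul_comm K]
    exact mul_le_mul_right (hbound w hw t s hts) _
  refine le_trans ?_ hstrip
  rw [capMeasure, capMeasure, sub_le_iff_le_add']
  refine (measureReal_mono ?_).trans (measureReal_union_le _ _)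
  intro x hx
  rcases le_total s (inner ℝ w (x : EuclideanSpace ℝ (Fin (n + 1)))) with h | h
  · exact Or.inl h
  · exact Or.inr ⟨hx, h⟩

/-! ### Discrepancy under perturbation of the points. -/

theorem capMeasure_mem_Icc {n : ℕ} (w : EuclideanSpace ℝ (Fin (n + 1))) (t : ℝ) :
    capMeasure w t ∈ Set.Icc (0 : ℝ) 1 :=
  ⟨measureReal_nonneg, measureReal_le_one⟩

theorem empMeasure_mem_Icc {d N : ℕ} (X : PointSets d N) (w : EuclideanSpace ℝ (Fin d)) (t : ℝ) :
    empMeasure X w t ∈ Set.Icc (0 : ℝ) 1 := by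
  refine ⟨by unfold empMeasure; positivity, ?_⟩
  refine inv_mul_le_one_of_le₀ ?_ (Nat.cast_nonneg _)
  exact_mod_cast (Set.ncard_le_card _).trans_eq (Nat.card_fin N)

theorem empMeasure_le_of_imp {d N : ℕ} {X Y : PointSets d N} {w v : EuclideanSpace ℝ (Fin d)}
    {t s : ℝ} (h : ∀ i, X i ∈ halfSpace w t → Y i ∈ halfSpace v s) :
    empMeasure X w t ≤ empMeasure Y v s := by
  refine mul_le_mul_of_nonneg_left ?_ (by positivity)
  exact_mod_cast Set.ncard_le_ncard h (Set.toFinite _)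

theorem abs_sub_le_one_of_mem_Icc {a b : ℝ} (ha : a ∈ Set.Icc (0 : ℝ) 1)
    (hb : b ∈ Set.Icc (0 : ℝ) 1) : |a - b| ≤ 1 :=
  abs_le.2 ⟨by linarith [ha.1, hb.2], by linarith [ha.2, hb.1]⟩

theorem le_capDiscrepancy_of_mem {n N : ℕ} (X : PointSets (n + 1) N)
    {w : EuclideanSpace ℝ (Fin (n + 1))} (hw : ‖w‖ = 1) {t : ℝ} (ht : t ∈ Set.Icc (-1 : ℝ) 1) :
    |empMeasure X w t - capMeasure w t| ≤ capDiscrepancy X := by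
  refine le_ciSup (f := fun p : sphere (0 : EuclideanSpace ℝ (Fin (n + 1))) 1 ×
    Set.Icc (-1 : ℝ) 1 => |empMeasure X (p.1 : EuclideanSpace ℝ (Fin (n + 1))) (p.2 : ℝ)
      - capMeasure (p.1 : EuclideanSpace ℝ (Fin (n + 1))) (p.2 : ℝ)|)
    ⟨1, ?_⟩ (⟨w, mem_sphere_zero_iff_norm.2 hw⟩, ⟨t, ht⟩)
  rintro _ ⟨p, rfl⟩
  exact abs_sub_le_one_of_mem_Icc (empMeasure_mem_Icc _ _ _) (capMeasure_mem_Icc _ _)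

theorem capDiscrepancy_nonneg {d N : ℕ} (X : PointSets d N) : 0 ≤ capDiscrepancy X :=
  Real.iSup_nonneg fun _ => abs_nonneg _

/-- The shifted heights `t ± η` may leave `[-1, 1]`. There the cap is empty or the whole sphere, and
the local discrepancy vanishes. -/
theorem le_capDiscrepancy {n N : ℕ} (hN : 1 ≤ N) {X : PointSets (n + 1) N}
    (hX : X ∈ onSphere (n + 1) N) {w : EuclideanSpace ℝ (Fin (n + 1))} (hw : ‖w‖ = 1) (t : ℝ) :
    |empMeasure X w t - capMeasure w t| ≤ capDiscrepancy X := by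
  have hinner : ∀ x ∈ sphere (0 : EuclideanSpace ℝ (Fin (n + 1))) 1, |inner ℝ w x| ≤ 1 := by
    intro x hx
    have := abs_real_inner_le_norm w x
    rwa [hw, mem_sphere_zero_iff_norm.1 hx, mul_one] at this
  by_cases ht : t ∈ Set.Icc (-1 : ℝ) 1
  · exact le_capDiscrepancy_of_mem X hw ht
  suffices empMeasure X w t = capMeasure w t by
    rw [this, sub_self, abs_zero]
    exact capDiscrepancy_nonneg X
  rcases lt_or_ge 1 t with h1 | h1
  · have hemp : ∀ x ∈ sphere (0 : EuclideanSpace ℝ (Fin (n + 1))) 1, x ∉ halfSpace w t :=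
      fun x hx h => absurd (h1.trans_le h) (abs_le.1 (hinner x hx)).2.not_gt
    simp [empMeasure, capMeasure, fun i => hemp _ (hX i),
      fun x : sphere (0 : EuclideanSpace ℝ (Fin (n + 1))) 1 => hemp _ x.2]
  · have hlt : t < -1 := lt_of_not_ge fun h => ht ⟨h, h1⟩
    have hfull : ∀ x ∈ sphere (0 : EuclideanSpace ℝ (Fin (n + 1))) 1, x ∈ halfSpace w t :=
      fun x hx => hlt.le.trans (abs_le.1 (hinner x hx)).1
    have hN0 : (N : ℝ) ≠ 0 := Nat.cast_ne_zero.2 (by omega)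
    simp [empMeasure, capMeasure, fun i => hfull _ (hX i),
      fun x : sphere (0 : EuclideanSpace ℝ (Fin (n + 1))) 1 => hfull _ x.2, hN0]

theorem abs_inner_sub_le {d N : ℕ} (X Y : PointSets d N) {w : EuclideanSpace ℝ (Fin d)}
    (hw : ‖w‖ = 1) (i : Fin N) : |inner ℝ w (X i) - inner ℝ w (Y i)| ≤ ‖X - Y‖ := by
  rw [← inner_sub_right]
  refine (abs_real_inner_le_norm _ _).trans ?_
  rw [hw, one_mul]
  exact PiLp.norm_apply_le (X - Y) i

/-- On the sphere of dimension at least two, moving every point by at most `η` can be compensated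
by changing the height of a cap by `η`, which changes its measure by at most a multiple of `η`. -/
theorem exists_capDiscrepancy_le {n N : ℕ} (hn : 2 ≤ n) (hN : 1 ≤ N) :
    ∃ C : ℝ, 0 ≤ C ∧ ∀ X : PointSets (n + 1) N, ∀ Y ∈ onSphere (n + 1) N,
      capDiscrepancy X ≤ capDiscrepancy Y + C * ‖X - Y‖ := by
  obtain ⟨C, hC, hcap⟩ := exists_capMeasure_sub_le hn
  refine ⟨C, hC, fun X Y hY => ?_⟩
  refine Real.iSup_le ?_ (add_nonneg (capDiscrepancy_nonneg Y) (by positivity))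
  rintro ⟨⟨w, hw⟩, ⟨t, -⟩⟩
  rw [mem_sphere_zero_iff_norm] at hw
  set η := ‖X - Y‖
  have hη : 0 ≤ η := norm_nonneg _
  have hXY := fun i => abs_le.1 (abs_inner_sub_le X Y hw i)
  have hlow := abs_le.1 (le_capDiscrepancy hN hY hw (t - η))
  have hupp := abs_le.1 (le_capDiscrepancy hN hY hw (t + η))
  have hcl := hcap w hw (t - η) t (by linarith)
  have hcu := hcap w hw t (t + η) (by linarith)
  have hel : empMeasure X w t ≤ empMeasure Y w (t - η) :=
    empMeasure_le_of_imp fun i (hi : t ≤ inner ℝ w (X i)) =>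
      (by linarith [(hXY i).2] : t - η ≤ inner ℝ w (Y i))
  have heu : empMeasure Y w (t + η) ≤ empMeasure X w t :=
    empMeasure_le_of_imp fun i (hi : t + η ≤ inner ℝ w (Y i)) =>
      (by linarith [(hXY i).1] : t ≤ inner ℝ w (X i))
  rw [sub_sub_cancel] at hcl
  rw [add_sub_cancel_left] at hcu
  exact abs_le.2 ⟨by linarith [hupp.1], by linarith [hlow.2]⟩

/-! ### Openness of genericity and conclusion. -/

theorem isOpen_generic (d N : ℕ) : IsOpen {X : PointSets d N | Generic X} := by
  simp only [Generic, Set.ofPred_forall]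
  refine isOpen_iInter_of_finite fun I => isOpen_iInter_of_finite fun _ => ?_
  refine isOpen_setOfPred_linearIndependent.preimage
    (f := fun (X : PointSets d N) (i : I) => X i) ?_
  fun_prop

theorem corollary4p9 (d N : ℕ) (hd : 3 ≤ d) (hN : 1 ≤ N)
    (Xbar : PointSets d N) (hXbar : Xbar ∈ onSphere d N) (hgen : Generic Xbar) :
    ∃ U ∈ 𝓝 Xbar,
      (∀ X ∈ U ∩ onSphere d N, Generic X) ∧
      ∃ L : ℝ, 0 < L ∧ ∀ X₁ ∈ U ∩ onSphere d N, ∀ X₂ ∈ U ∩ onSphere d N,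
        |capDiscrepancy X₁ - capDiscrepancy X₂| ≤ L * ‖X₁ - X₂‖ := by
  refine ⟨{X | Generic X}, (isOpen_generic d N).mem_nhds hgen, fun X hX => hX.1, ?_⟩
  obtain ⟨n, rfl⟩ : ∃ n, d = n + 1 := ⟨d - 1, by omega⟩
  obtain ⟨C, hC, h⟩ := exists_capDiscrepancy_le (n := n) (by omega) hN
  -- `C` may be zero, while the Lipschitz constant must be positive.
  refine ⟨C + 1, by linarith, fun X hX Y hY => ?_⟩
  have h1 := h X Y hY.2
  have h2 := h Y X hX.2
  rw [norm_sub_rev] at h2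
  have h3 := norm_nonneg (X - Y)
  exact abs_le.2 ⟨by linarith, by linarith⟩
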